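/- Let $f$ be a $C^\infty$ diffeomorphism of $[0,1]$ onto itself with $f(0)=0$, $f(1)=1$ (derivatives at the endpoints are one-sided). For $n\ge 1$ let $f^n$ be the $n$-th iterate of $f$, let $f^{-n}$ be the $n$-th iterate of $f^{-1}$, and put $$\Gamma_n(f)=\max\Bigl(\max_{x\in[0,1]}|(f^n)'(x)|,\ \max_{x\in[0,1]}|(f^{-n})'(x)|\Bigr).$$ Let $E(f)=\{x\in[0,1]: f(x)=x\}$, and $$E_1(f)=\{x\in E(f): f'(x)\ne 1\},$$ $$E_k(f)=\{x\in E(f): f'(x)=1,\ f''(x)=\dots=f^{(k-1)}(x)=0,\ f^{(k)}(x)\ne 0\}\quad (k\ge 2),$$ $$E_\infty(f)=\{x\in E(f): f'(x)=1,\ f^{(j)}(x)=0\text{ for all } j\ge 2\}.$$ Write $a(n)\asymp b(n)$ if there are constants $0<c\le C<\infty$ (depending on the two sequences) with $c\,b(n)\le a(n)\le C\,b(n)$ for all sufficiently large $n$. Assume $E_1(f)=\emptyset$. Then: (A) If $E_2(f)\ne\emptyset$, then $\Gamma_n(f)\asymp n^2$ as $n\to\infty$. (B) If $E_2(f)=\emptyset$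 and $E_\infty(f)\ne\emptyset$, then $\Gamma_n(f)=o(n^2)$ as $n\to\infty$. (C) If $k\ge 3$, $E_s(f)=\emptyset$ for all integers $1<s<k$, $E_\infty(f)=\emptyset$ and $E_k(f)\ne\emptyset$, then $\Gamma_n(f)\asymp n^{k/(k-1)}$ as $n\to\infty$. -/

import Mathlib

open Set Filter Asymptotics
open scoped ContDiff

namespace IntervalGrowth

/-- A `C^∞` diffeomorphism of `[0,1]` onto itself fixing both endpoints, together with its inverse.
Only the values on `[0,1]` matter; smoothness is one-sided at the endpoints. -/
structure IntervalDiffeo where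
  /-- the diffeomorphism -/
  toFun : ℝ → ℝ
  /-- its inverse -/
  invFun : ℝ → ℝ
  mapsTo : MapsTo toFun (Icc 0 1) (Icc 0 1)
  mapsTo_inv : MapsTo invFun (Icc 0 1) (Icc 0 1)
  leftInv : LeftInvOn invFun toFun (Icc 0 1)
  rightInv : RightInvOn invFun toFun (Icc 0 1)
  smooth : ContDiffOn ℝ ∞ toFun (Icc 0 1)
  smooth_inv : ContDiffOn ℝ ∞ invFun (Icc 0 1)
  map_zero : toFun 0 = 0
  map_one : toFun 1 = 1

/-- The `j`-th derivative of `h` at `x` as a function on `[0,1]` (one-sided at `0` and `1`). -/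
noncomputable def D (j : ℕ) (h : ℝ → ℝ) (x : ℝ) : ℝ :=
  iteratedDerivWithin j h (Icc 0 1) x

/-- `E(f)`: the fixed points of `f` in `[0,1]`. -/
def fixedSet (f : IntervalDiffeo) : Set ℝ :=
  {x | x ∈ Icc (0 : ℝ) 1 ∧ f.toFun x = x}

/-- `E₁(f)`: the fixed points with `f' ≠ 1`. -/
def hyperbolicSet (f : IntervalDiffeo) : Set ℝ :=
  {x | x ∈ fixedSet f ∧ D 1 f.toFun x ≠ 1}

/-- `E_k(f)` for `k ≥ 2`: the fixed points with `f' = 1`, `f'' = ⋯ = f^(k-1) = 0`, `f^(k) ≠ 0`. -/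
def orderSet (f : IntervalDiffeo) (k : ℕ) : Set ℝ :=
  {x | x ∈ fixedSet f ∧ D 1 f.toFun x = 1 ∧
    (∀ j, 2 ≤ j → j < k → D j f.toFun x = 0) ∧ D k f.toFun x ≠ 0}

/-- `E_∞(f)`: the fixed points with `f' = 1` and all higher derivatives zero. -/
def flatSet (f : IntervalDiffeo) : Set ℝ :=
  {x | x ∈ fixedSet f ∧ D 1 f.toFun x = 1 ∧ ∀ j, 2 ≤ j → D j f.toFun x = 0}

/-- `max |h'|` over `[0,1]` (attained for `h` continuously differentiable on `[0,1]`). -/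
noncomputable def maxAbsDeriv (h : ℝ → ℝ) : ℝ :=
  sSup ((fun x => |D 1 h x|) '' Icc 0 1)

/-- The growth sequence `Γ_n(f) = max (max |(f^n)'|) (max |(f^{-n})'|)`. -/
noncomputable def growth (f : IntervalDiffeo) (n : ℕ) : ℝ :=
  max (maxAbsDeriv (f.toFun^[n])) (maxAbsDeriv (f.invFun^[n]))

end IntervalGrowth

/-!
Write `u x = |f x - x|` for the displacement and `x₀, x₁, …` for the orbit of a point that is not
fixed. Such an orbit is monotone, so `∑ u xᵢ ≤ 1`, and by the mean value theorem `f' xᵢ` equals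
`u xᵢ₊₁ / u xᵢ` up to a factor `exp (O (u xᵢ))`. Hence `(f^n)' x₀` is at most a constant times
`u xₙ / u x₀`, and the growth is governed by how fast a displacement can increase along an orbit.

*Upper bounds.* Suppose `|f' - 1| ≤ ε * u ^ α` wherever `u ≤ η` (`GapBound`). The derivative of
`u ^ (-α)` is then at most `ε / u`, and `u` is comparable to `u xᵢ` on the segment from `xᵢ` to
`xᵢ₊₁`, which has length `u xᵢ`. Thus `u ^ (-α)` drops by `O (ε)` in one step, apart from the steps
with large `u`, whose total contribution is bounded since the steps add up to at most `1`. As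
`u ≤ 1`, this gives `u xₙ / u x₀ ≤ (B + A ε n) ^ (1 / α)` with `A` independent of `ε`
(`exists_growth_le`); the hypothesis passes to `f⁻¹`. It remains to find gap bounds.
* Without hyperbolic fixed points, `|f' - 1| ^ 2 ≤ 4 K u` for a Lipschitz constant `K` of `f'`
  (`sq_D_sub_one_le`): `α = 1 / 2` is always possible.
* If moreover `f''` vanishes at all fixed points, then `K` may be taken arbitrarily small near them,
  so `ε` is arbitrary, and the growth is `o (n ^ 2)`.
* If every fixed point has a finite order `m ≥ k`, Taylor expansion gives `u ≍ |x - p| ^ m` and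
  `f' - 1 = O (|x - p| ^ (m - 1))` near it, which is a gap bound with `α = (k - 1) / k`.

*Lower bounds.* At a fixed point `p` of order `k` one has `u ≍ |x - p| ^ k`. Near `p` some orbit of
`f` or of `f⁻¹` converges to `p`, and `t = |x - p|` satisfies `tᵢ₊₁ ≤ tᵢ - c tᵢ ^ k`, whence
`tₙ ^ (k - 1) ≤ 1 / (c n)` and `u xₙ = O (n ^ (-k / (k - 1)))`. The `n`-th iterate of the inverse
maps the segment from `xₙ` to `xₙ₊₁` onto the one from `x₀` to `x₁`, so its derivative is somewhere
at least `u x₀ / u xₙ`.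
-/

namespace IntervalGrowth

/-! ### First-order calculus of interval diffeomorphisms -/

lemma D_one (h : ℝ → ℝ) (x : ℝ) : D 1 h x = derivWithin h (Icc 0 1) x := by
  simp [D, iteratedDerivWithin_one]

lemma uniqueDiffOn_unitInterval : UniqueDiffOn ℝ (Icc (0 : ℝ) 1) :=
  uniqueDiffOn_Icc zero_lt_one

lemma D_one_eq {h : ℝ → ℝ} {d x : ℝ} (hx : x ∈ Icc (0 : ℝ) 1)
    (hd : HasDerivWithinAt h d (Icc 0 1) x) : D 1 h x = d := by
  rw [D_one]
  exact hd.derivWithin (uniqueDiffOn_unitInterval x hx)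

lemma contDiffOn_D_one {h : ℝ → ℝ} (hh : ContDiffOn ℝ ∞ h (Icc 0 1)) :
    ContDiffOn ℝ ∞ (D 1 h) (Icc 0 1) := by
  have : D 1 h = derivWithin h (Icc 0 1) := funext (D_one h)
  rw [this]
  exact hh.derivWithin uniqueDiffOn_unitInterval (by simp)

lemma hasDerivWithinAt_D_one {h : ℝ → ℝ} (hh : ContDiffOn ℝ ∞ h (Icc 0 1)) {x : ℝ}
    (hx : x ∈ Icc (0 : ℝ) 1) : HasDerivWithinAt h (D 1 h x) (Icc 0 1) x := by
  rw [D_one]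
  exact ((hh.differentiableOn (by simp)) x hx).hasDerivWithinAt

/-- The mean value theorem for one-sided derivatives on `[0,1]`, with unordered endpoints. -/
lemma exists_mem_uIcc_eq_mul {h d : ℝ → ℝ}
    (hd : ∀ x ∈ Icc (0 : ℝ) 1, HasDerivWithinAt h (d x) (Icc 0 1) x) {x y : ℝ}
    (hx : x ∈ Icc (0 : ℝ) 1) (hy : y ∈ Icc (0 : ℝ) 1) (hxy : x ≠ y) :
    ∃ c ∈ uIcc x y, h y - h x = d c * (y - x) := by
  wlog hlt : x < y generalizing x y
  · obtain ⟨c, hc, e⟩ := this hy hx hxy.symm (lt_of_le_of_ne (not_lt.1 hlt) hxy.symm)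
    exact ⟨c, by rwa [uIcc_comm], by linarith⟩
  have hsub : Icc x y ⊆ Icc (0 : ℝ) 1 := Icc_subset_Icc hx.1 hy.2
  obtain ⟨c, hc, e⟩ := exists_hasDerivAt_eq_slope h d hlt
    (fun z hz => ((hd z (hsub hz)).continuousWithinAt).mono hsub)
    (fun z hz => (hd z (hsub (Ioo_subset_Icc_self hz))).hasDerivAt
      (Icc_mem_nhds (hx.1.trans_lt hz.1) (hz.2.trans_le hy.2)))
  refine ⟨c, by rw [uIcc_of_le hlt.le]; exact Ioo_subset_Icc_self hc, ?_⟩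
  rw [e, div_mul_cancel₀]
  exact sub_ne_zero.2 hlt.ne'

lemma exists_abs_sub_le {h : ℝ → ℝ} (hh : ContDiffOn ℝ ∞ h (Icc 0 1)) :
    ∃ M : ℝ, (∀ x ∈ Icc (0 : ℝ) 1, |D 1 h x| ≤ M) ∧
      ∀ x ∈ Icc (0 : ℝ) 1, ∀ y ∈ Icc (0 : ℝ) 1, |h x - h y| ≤ M * |x - y| := by
  obtain ⟨M, hM⟩ := isCompact_Icc.exists_bound_of_continuousOn (contDiffOn_D_one hh).continuousOn
  refine ⟨M, hM, fun x hx y hy => ?_⟩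
  exact (convex_Icc (0 : ℝ) 1).norm_image_sub_le_of_norm_hasDerivWithin_le
    (fun z hz => hasDerivWithinAt_D_one hh hz) hM hy hx

namespace IntervalDiffeo

/-- The inverse diffeomorphism. -/
def symm (f : IntervalDiffeo) : IntervalDiffeo where
  toFun := f.invFun
  invFun := f.toFun
  mapsTo := f.mapsTo_inv
  mapsTo_inv := f.mapsTo
  leftInv := f.rightInv
  rightInv := f.leftInv
  smooth := f.smooth_inv
  smooth_inv := f.smooth
  map_zero := by
    have := f.leftInv (show (0 : ℝ) ∈ Icc (0 : ℝ) 1 by simp)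
    rwa [f.map_zero] at this
  map_one := by
    have := f.leftInv (show (1 : ℝ) ∈ Icc (0 : ℝ) 1 by simp)
    rwa [f.map_one] at this

variable (f : IntervalDiffeo) {x y : ℝ}

lemma growth_symm (n : ℕ) : growth f.symm n = growth f n := max_comm _ _

lemma strictMonoOn : StrictMonoOn f.toFun (Icc 0 1) :=
  f.smooth.continuousOn.strictMonoOn_of_injOn_Icc zero_le_one
    (by rw [f.map_zero, f.map_one]; exact zero_le_one) f.leftInv.injOn

lemma iterate_mem (hx : x ∈ Icc (0 : ℝ) 1) (n : ℕ) : f.toFun^[n] x ∈ Icc (0 : ℝ) 1 :=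
  f.mapsTo.iterate n hx

lemma invFun_iterate_iterate (hx : x ∈ Icc (0 : ℝ) 1) (n : ℕ) :
    f.invFun^[n] (f.toFun^[n] x) = x := by
  induction n with
  | zero => rfl
  | succ n ih =>
    rw [Function.iterate_succ_apply, Function.iterate_succ_apply', f.leftInv (f.iterate_mem hx n),
      ih]

lemma D_symm_mul_D (hx : x ∈ Icc (0 : ℝ) 1) :
    D 1 f.invFun (f.toFun x) * D 1 f.toFun x = 1 := by
  have h1 := (hasDerivWithinAt_D_one f.smooth_inv (f.mapsTo hx)).comp x
    (hasDerivWithinAt_D_one f.smooth hx) f.mapsTo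
  have h2 : HasDerivWithinAt (f.invFun ∘ f.toFun) 1 (Icc 0 1) x :=
    (hasDerivWithinAt_id x _).congr (fun y hy => f.leftInv hy) (f.leftInv hx)
  exact (D_one_eq hx h1).symm.trans (D_one_eq hx h2)

/-- A single constant controls the first two derivatives of `f` and the first one of `f⁻¹`. -/
lemma exists_bound : ∃ M : ℝ, 1 ≤ M ∧
    (∀ x ∈ Icc (0 : ℝ) 1, ∀ y ∈ Icc (0 : ℝ) 1, |f.toFun x - f.toFun y| ≤ M * |x - y|) ∧
    (∀ x ∈ Icc (0 : ℝ) 1, ∀ y ∈ Icc (0 : ℝ) 1, |x - y| ≤ M * |f.toFun x - f.toFun y|) ∧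
    (∀ x ∈ Icc (0 : ℝ) 1, ∀ y ∈ Icc (0 : ℝ) 1, |D 1 f.toFun x - D 1 f.toFun y| ≤ M * |x - y|) ∧
    (∀ x ∈ Icc (0 : ℝ) 1, 1 ≤ M * D 1 f.toFun x) ∧
    ∀ x ∈ Icc (0 : ℝ) 1, |D 1 f.invFun x| ≤ M := by
  obtain ⟨M₁, -, h1⟩ := exists_abs_sub_le f.smooth
  obtain ⟨M₂, h2', h2⟩ := exists_abs_sub_le f.smooth_inv
  obtain ⟨M₃, -, h3⟩ := exists_abs_sub_le (contDiffOn_D_one f.smooth)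
  let M := max 1 (max M₁ (max M₂ M₃))
  have e1 : M₁ ≤ M := (le_max_left _ _).trans (le_max_right _ _)
  have e2 : M₂ ≤ M := ((le_max_left _ _).trans (le_max_right _ _)).trans (le_max_right _ _)
  have e3 : M₃ ≤ M := ((le_max_right _ _).trans (le_max_right _ _)).trans (le_max_right _ _)
  refine ⟨M, le_max_left _ _, fun x hx y hy => (h1 x hx y hy).trans (by gcongr),
    fun x hx y hy => ?_, fun x hx y hy => (h3 x hx y hy).trans (by gcongr), fun x hx => ?_,
    fun x hx => (h2' x hx).trans e2⟩
  · have := h2 _ (f.mapsTo hx) _ (f.mapsTo hy)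
    rw [f.leftInv hx, f.leftInv hy] at this
    exact this.trans (by gcongr)
  · have hnn : 0 ≤ D 1 f.toFun x := by
      rw [D_one]
      exact f.strictMonoOn.monotoneOn.derivWithin_nonneg
    have := f.D_symm_mul_D hx
    have hle : D 1 f.invFun (f.toFun x) ≤ M :=
      (le_abs_self _).trans ((h2' _ (f.mapsTo hx)).trans e2)
    nlinarith

lemma hasDerivWithinAt_iterate (hx : x ∈ Icc (0 : ℝ) 1) (n : ℕ) :
    HasDerivWithinAt (f.toFun^[n]) (∏ i ∈ Finset.range n, D 1 f.toFun (f.toFun^[i] x))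
      (Icc 0 1) x := by
  induction n with
  | zero => simpa using hasDerivWithinAt_id x (Icc 0 1)
  | succ n ih =>
    rw [Function.iterate_succ', Finset.prod_range_succ, mul_comm]
    exact (hasDerivWithinAt_D_one f.smooth (f.iterate_mem hx n)).comp x ih
      (f.mapsTo.iterate n)

lemma contDiffOn_iterate (n : ℕ) : ContDiffOn ℝ ∞ (f.toFun^[n]) (Icc 0 1) := by
  induction n with
  | zero => exact contDiffOn_id
  | succ n ih =>
    rw [Function.iterate_succ']
    exact f.smooth.comp ih (f.mapsTo.iterate n)

lemma abs_D_iterate_le_maxAbsDeriv (hx : x ∈ Icc (0 : ℝ) 1) (n : ℕ) :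
    |D 1 (f.toFun^[n]) x| ≤ maxAbsDeriv (f.toFun^[n]) := by
  obtain ⟨M, hM, -⟩ := exists_abs_sub_le (f.contDiffOn_iterate n)
  refine le_csSup ⟨M, ?_⟩ (mem_image_of_mem _ hx)
  rintro _ ⟨y, hy, rfl⟩
  exact hM y hy

/-- By the mean value theorem, a segment stretched by `f^n` bounds `Γ_n(f)` from below. -/
lemma abs_sub_le_growth_mul (hx : x ∈ Icc (0 : ℝ) 1) (hy : y ∈ Icc (0 : ℝ) 1) (n : ℕ) :
    |f.toFun^[n] y - f.toFun^[n] x| ≤ growth f n * |y - x| := by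
  rcases eq_or_ne x y with rfl | hne
  · simp
  obtain ⟨c, hc, e⟩ := exists_mem_uIcc_eq_mul
    (fun z hz => hasDerivWithinAt_D_one (f.contDiffOn_iterate n) hz) hx hy hne
  rw [e, abs_mul]
  gcongr
  exact (f.abs_D_iterate_le_maxAbsDeriv (ordConnected_Icc.uIcc_subset hx hy hc) n).trans
    (le_max_left _ _)

/-- The orbit of a point is monotone, so the lengths of its successive steps add up to at
most `1`. -/
lemma sum_abs_step_le_one (hx : x ∈ Icc (0 : ℝ) 1) (n : ℕ) :
    ∑ i ∈ Finset.range n, |f.toFun^[i + 1] x - f.toFun^[i] x| ≤ 1 := by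
  have key : ∀ z ∈ Icc (0 : ℝ) 1, ∀ w ∈ Icc (0 : ℝ) 1, |z - w| ≤ 1 := fun z hz w hw =>
    abs_le.2 ⟨by linarith [hz.1, hw.2], by linarith [hz.2, hw.1]⟩
  rcases le_total x (f.toFun x) with h | h
  · have hm : ∀ i, f.toFun^[i] x ≤ f.toFun^[i + 1] x := by
      intro i
      induction i with
      | zero => exact h
      | succ i ih =>
        rw [Function.iterate_succ_apply' _ (i + 1), Function.iterate_succ_apply' _ i]
        rw [Function.iterate_succ_apply' _ i] at ih
        exact f.strictMonoOn.monotoneOn (f.iterate_mem hx i) (f.mapsTo (f.iterate_mem hx i)) ih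
    have e : ∀ i ∈ Finset.range n, |f.toFun^[i + 1] x - f.toFun^[i] x|
        = f.toFun^[i + 1] x - f.toFun^[i] x := fun i _ => abs_of_nonneg (sub_nonneg.2 (hm i))
    rw [Finset.sum_congr rfl e, Finset.sum_range_sub (fun i => f.toFun^[i] x)]
    exact (le_abs_self _).trans (key _ (f.iterate_mem hx n) _ hx)
  · have hm : ∀ i, f.toFun^[i + 1] x ≤ f.toFun^[i] x := by
      intro i
      induction i with
      | zero => exact h
      | succ i ih =>
        rw [Function.iterate_succ_apply' _ (i + 1), Function.iterate_succ_apply' _ i]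
        rw [Function.iterate_succ_apply' _ i] at ih
        exact f.strictMonoOn.monotoneOn (f.mapsTo (f.iterate_mem hx i)) (f.iterate_mem hx i) ih
    have e : ∀ i ∈ Finset.range n, |f.toFun^[i + 1] x - f.toFun^[i] x|
        = f.toFun^[i] x - f.toFun^[i + 1] x := fun i _ => by
      rw [abs_sub_comm]; exact abs_of_nonneg (sub_nonneg.2 (hm i))
    rw [Finset.sum_congr rfl e, Finset.sum_range_sub' (fun i => f.toFun^[i] x)]
    exact (le_abs_self _).trans (key _ hx _ (f.iterate_mem hx n))

end IntervalDiffeo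

/-! ### Upper bounds for the growth -/

/-- Where the displacement `|f x - x|` is at most `η`, its derivative is bounded by `ε` times its
`α`-th power. -/
def GapBound (f : IntervalDiffeo) (α ε η : ℝ) : Prop :=
  ∀ x ∈ Icc (0 : ℝ) 1, |f.toFun x - x| ≤ η →
    |D 1 f.toFun x - 1| ≤ ε * |f.toFun x - x| ^ α

namespace IntervalDiffeo

variable (f : IntervalDiffeo) {x y M : ℝ}

/-- The displacement varies by a bounded factor on the segment from `x` to `f x`. -/
lemma abs_step_comparable (hM : 1 ≤ M)
    (h1 : ∀ x ∈ Icc (0 : ℝ) 1, ∀ y ∈ Icc (0 : ℝ) 1, |f.toFun x - f.toFun y| ≤ M * |x - y|)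
    (h2 : ∀ x ∈ Icc (0 : ℝ) 1, ∀ y ∈ Icc (0 : ℝ) 1, |x - y| ≤ M * |f.toFun x - f.toFun y|)
    (hx : x ∈ Icc (0 : ℝ) 1) (hy : y ∈ uIcc x (f.toFun x)) :
    |f.toFun x - x| ≤ M * |f.toFun y - y| ∧ |f.toFun y - y| ≤ M * |f.toFun x - x| := by
  have hyI : y ∈ Icc (0 : ℝ) 1 := ordConnected_Icc.uIcc_subset hx (f.mapsTo hx) hy
  have a1 := h1 y hyI x hx
  have a2 := h2 y hyI x hx
  rcases le_total x (f.toFun x) with h | h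
  · rw [uIcc_of_le h] at hy
    have hm := f.strictMonoOn.monotoneOn hx hyI hy.1
    rw [abs_of_nonneg (sub_nonneg.2 hm), abs_of_nonneg (sub_nonneg.2 hy.1)] at a1 a2
    rw [abs_of_nonneg (by linarith), abs_of_nonneg (by linarith [hy.2])]
    constructor <;> nlinarith [hy.1, hy.2]
  · rw [uIcc_of_ge h] at hy
    have hm := f.strictMonoOn.monotoneOn hyI hx hy.2
    rw [abs_of_nonpos (sub_nonpos.2 hm), abs_of_nonpos (sub_nonpos.2 hy.2)] at a1 a2
    rw [abs_of_nonpos (by linarith), abs_of_nonpos (by linarith [hy.1])]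
    constructor <;> nlinarith [hy.1, hy.2]

/-- Up to a factor with bounded product along the orbit, `f'(x)` is the ratio of two successive
steps. -/
lemma D_le_exp_mul_div (hM : 1 ≤ M)
    (h3 : ∀ x ∈ Icc (0 : ℝ) 1, ∀ y ∈ Icc (0 : ℝ) 1,
      |D 1 f.toFun x - D 1 f.toFun y| ≤ M * |x - y|)
    (h4 : ∀ x ∈ Icc (0 : ℝ) 1, 1 ≤ M * D 1 f.toFun x)
    (hx : x ∈ Icc (0 : ℝ) 1) (hfx : f.toFun x ≠ x) :
    D 1 f.toFun x ≤ Real.exp (M ^ 2 * |f.toFun x - x|) *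
      (|f.toFun (f.toFun x) - f.toFun x| / |f.toFun x - x|) := by
  obtain ⟨c, hc, e⟩ := exists_mem_uIcc_eq_mul
    (fun z hz => hasDerivWithinAt_D_one f.smooth hz) hx (f.mapsTo hx) hfx.symm
  have hcI : c ∈ Icc (0 : ℝ) 1 := ordConnected_Icc.uIcc_subset hx (f.mapsTo hx) hc
  have hcpos : 0 < D 1 f.toFun c := by
    have := h4 c hcI
    exact pos_of_mul_pos_right (by linarith) (by linarith : (0 : ℝ) ≤ M)
  have hpos : 0 < |f.toFun x - x| := abs_pos.2 (sub_ne_zero.2 hfx)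
  rw [e, abs_mul, mul_div_assoc, div_self hpos.ne', mul_one, abs_of_pos hcpos]
  have hd : |x - c| ≤ |f.toFun x - x| := by
    rw [abs_sub_comm]
    exact abs_sub_left_of_mem_uIcc hc
  have k1 := (le_abs_self _).trans (h3 x hx c hcI)
  have k2 : M * |x - c| ≤ M * |f.toFun x - x| := by gcongr
  have k3 : M * |f.toFun x - x| ≤ M * |f.toFun x - x| * (M * D 1 f.toFun c) :=
    le_mul_of_one_le_right (by positivity) (h4 c hcI)
  have k4 := Real.add_one_le_exp (M ^ 2 * |f.toFun x - x|)
  nlinarith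

/-- The effect of one iterate on the negative power `|f x - x| ^ (-α)`: where the displacement is
small the mean value theorem bounds the decrease by a multiple of `ε`, elsewhere the whole power
is bounded by a multiple of the step. -/
lemma rpow_neg_abs_step_le (hM : 1 ≤ M)
    (h1 : ∀ x ∈ Icc (0 : ℝ) 1, ∀ y ∈ Icc (0 : ℝ) 1, |f.toFun x - f.toFun y| ≤ M * |x - y|)
    (h2 : ∀ x ∈ Icc (0 : ℝ) 1, ∀ y ∈ Icc (0 : ℝ) 1, |x - y| ≤ M * |f.toFun x - f.toFun y|)
    {α ε η : ℝ} (hα : 0 < α) (hα1 : α ≤ 1) (hε : 0 ≤ ε) (hη : 0 < η) (hg : GapBound f α ε η)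
    (hx : x ∈ Icc (0 : ℝ) 1) (hfx : f.toFun x ≠ x) :
    |f.toFun x - x| ^ (-α) ≤ |f.toFun (f.toFun x) - f.toFun x| ^ (-α) + M * ε +
      (η / M) ^ (-α) * (M / η) * |f.toFun x - x| := by
  have hM0 : 0 < M := by linarith
  have hpos : 0 < |f.toFun x - x| := abs_pos.2 (sub_ne_zero.2 hfx)
  have hB : 0 ≤ (η / M) ^ (-α) * (M / η) * |f.toFun x - x| := by positivity
  rcases le_or_gt (M * |f.toFun x - x|) η with hs | hs
  · have hsub : uIcc x (f.toFun x) ⊆ Icc (0 : ℝ) 1 :=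
      ordConnected_Icc.uIcc_subset hx (f.mapsTo hx)
    have hcmp := fun y (hy : y ∈ uIcc x (f.toFun x)) => f.abs_step_comparable hM h1 h2 hx hy
    have hypos : ∀ y ∈ uIcc x (f.toFun x), 0 < |f.toFun y - y| := fun y hy =>
      pos_of_mul_pos_right (hpos.trans_le (hcmp y hy).1) hM0.le
    have hder : ∀ y ∈ uIcc x (f.toFun x), HasDerivWithinAt
        (fun y => |f.toFun y - y| ^ (-α))
        ((SignType.sign (f.toFun y - y) : ℝ) * (D 1 f.toFun y - 1) * (-α) *
          |f.toFun y - y| ^ (-α - 1)) (uIcc x (f.toFun x)) y := by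
      intro y hy
      have a1 := ((hasDerivWithinAt_D_one f.smooth (hsub hy)).sub
        (hasDerivWithinAt_id y _)).mono hsub
      exact ((hasDerivAt_abs (abs_pos.1 (hypos y hy))).comp_hasDerivWithinAt
        (h := fun y => f.toFun y - y) y a1).rpow_const
        (Or.inl (hypos y hy).ne')
    have hbd : ∀ y ∈ uIcc x (f.toFun x),
        ‖(SignType.sign (f.toFun y - y) : ℝ) * (D 1 f.toFun y - 1) * (-α) *
          |f.toFun y - y| ^ (-α - 1)‖ ≤ M * ε / |f.toFun x - x| := by
      intro y hy
      have hy0 := hypos y hy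
      have hgy := hg y (hsub hy) ((hcmp y hy).2.trans hs)
      have hsign : |(SignType.sign (f.toFun y - y) : ℝ)| ≤ 1 := by
        rcases lt_trichotomy (f.toFun y - y) 0 with h | h | h <;> simp [h]
      rw [Real.norm_eq_abs, abs_mul, abs_mul, abs_mul, abs_neg, abs_of_pos hα,
        abs_of_pos (Real.rpow_pos_of_pos hy0 _)]
      calc _ ≤ 1 * (ε * |f.toFun y - y| ^ α) * 1 * |f.toFun y - y| ^ (-α - 1) := by gcongr
        _ = ε * (|f.toFun y - y| ^ α * |f.toFun y - y| ^ (-α - 1)) := by ring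
        _ = ε / |f.toFun y - y| := by
          rw [← Real.rpow_add hy0, show α + (-α - 1) = -1 by ring, Real.rpow_neg_one]; rfl
        _ ≤ M * ε / |f.toFun x - x| := by
          rw [div_le_div_iff₀ hy0 hpos]
          nlinarith [(hcmp y hy).1]
    have := (convex_uIcc x (f.toFun x)).norm_image_sub_le_of_norm_hasDerivWithin_le hder hbd
      right_mem_uIcc left_mem_uIcc
    rw [Real.norm_eq_abs, Real.norm_eq_abs, abs_sub_comm x, div_mul_cancel₀ _ hpos.ne'] at this
    linarith [le_abs_self (|f.toFun x - x| ^ (-α) - |f.toFun (f.toFun x) - f.toFun x| ^ (-α))]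
  · have k1 : |f.toFun x - x| ^ (-α) ≤ (η / M) ^ (-α) :=
      Real.rpow_le_rpow_of_nonpos (by positivity) (by rw [div_le_iff₀ hM0]; linarith) (by linarith)
    have k2 : 1 ≤ M / η * |f.toFun x - x| := by
      rw [div_mul_eq_mul_div, one_le_div hη]; exact hs.le
    have k3 : (η / M) ^ (-α) ≤ (η / M) ^ (-α) * (M / η * |f.toFun x - x|) :=
      le_mul_of_one_le_right (by positivity) k2
    have k4 : 0 ≤ |f.toFun (f.toFun x) - f.toFun x| ^ (-α) := by positivity
    have k5 : 0 ≤ M * ε := by positivity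
    nlinarith

lemma iterate_step_ne_zero (hx : x ∈ Icc (0 : ℝ) 1) (hfx : f.toFun x ≠ x) (i : ℕ) :
    f.toFun^[i + 1] x ≠ f.toFun^[i] x := by
  induction i with
  | zero => exact hfx
  | succ i ih =>
    rw [Function.iterate_succ_apply' f.toFun (i + 1)]
    nth_rw 2 [Function.iterate_succ_apply' f.toFun i]
    exact fun h => ih (f.leftInv.injOn (f.iterate_mem hx _) (f.iterate_mem hx _) h)

/-- A gap bound makes `(f^n)'` grow at most like `(ε n) ^ (1 / α)`, with a multiplicative constant
not depending on `ε`. -/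
lemma exists_maxAbsDeriv_le : ∃ A : ℝ, 1 ≤ A ∧ ∀ α ε η : ℝ, 0 < α → α ≤ 1 → 0 ≤ ε → 0 < η →
    GapBound f α ε η → ∃ B : ℝ, 1 ≤ B ∧
      ∀ n : ℕ, maxAbsDeriv (f.toFun^[n]) ≤ A * (B + A * ε * n) ^ (1 / α) := by
  obtain ⟨M, hM, h1, h2, h3, h4, -⟩ := f.exists_bound
  have hM0 : 0 < M := by linarith
  have hAM : M ≤ Real.exp (M ^ 2) := by
    have := Real.add_one_le_exp (M ^ 2)
    nlinarith
  refine ⟨Real.exp (M ^ 2), hM.trans hAM, fun α ε η hα hα1 hε hη hg =>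
    ⟨1 + (η / M) ^ (-α) * (M / η), le_add_of_nonneg_right (by positivity), fun n => ?_⟩⟩
  set B := (η / M) ^ (-α) * (M / η) with hBdef
  have hB : 0 ≤ B := by positivity
  have hbase : 1 ≤ 1 + B + Real.exp (M ^ 2) * ε * n := by
    have : 0 ≤ Real.exp (M ^ 2) * ε * n := by positivity
    linarith
  refine csSup_le (Nonempty.image _ ⟨0, by simp⟩) ?_
  rintro _ ⟨x, hx, rfl⟩
  simp only
  rw [D_one_eq hx (f.hasDerivWithinAt_iterate hx n)]
  by_cases hfx : f.toFun x = x
  · -- the gap bound forces the derivative `1` at a fixed point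
    have hd : D 1 f.toFun x = 1 := by
      have := hg x hx (by simp [hfx, hη.le])
      rw [hfx, sub_self, abs_zero, Real.zero_rpow hα.ne', mul_zero] at this
      exact sub_eq_zero.1 (abs_eq_zero.1 (le_antisymm this (abs_nonneg _)))
    have hi : ∀ i, f.toFun^[i] x = x := fun i => Function.iterate_fixed hfx i
    simp only [hi, hd, Finset.prod_const_one, abs_one]
    exact one_le_mul_of_one_le_of_one_le (hM.trans hAM)
      (Real.one_le_rpow hbase (by positivity))
  set u : ℕ → ℝ := fun i => |f.toFun^[i + 1] x - f.toFun^[i] x| with hu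
  have hupos : ∀ i, 0 < u i := fun i => abs_pos.2 (sub_ne_zero.2 (f.iterate_step_ne_zero hx hfx i))
  have hune : ∀ i, f.toFun (f.toFun^[i] x) ≠ f.toFun^[i] x := fun i => by
    simpa only [Function.iterate_succ_apply'] using f.iterate_step_ne_zero hx hfx i
  have hu0 : ∀ i, |f.toFun (f.toFun^[i] x) - f.toFun^[i] x| = u i := fun i => by
    simp only [hu, Function.iterate_succ_apply']
  have hu1 : ∀ i, |f.toFun (f.toFun (f.toFun^[i] x)) - f.toFun (f.toFun^[i] x)| = u (i + 1) :=
    fun i => by simp only [hu, Function.iterate_succ_apply']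
  have hDpos : ∀ i, 0 ≤ D 1 f.toFun (f.toFun^[i] x) := fun i =>
    (pos_of_mul_pos_right (by linarith [h4 _ (f.iterate_mem hx i)]) hM0.le).le
  have hsum : ∑ i ∈ Finset.range n, u i ≤ 1 := f.sum_abs_step_le_one hx n
  have hprod : ∀ m : ℕ, ∏ i ∈ Finset.range m, D 1 f.toFun (f.toFun^[i] x) ≤
      Real.exp (M ^ 2 * ∑ i ∈ Finset.range m, u i) * (u m / u 0) := by
    intro m
    induction m with
    | zero => simp [div_self (hupos 0).ne']
    | succ m ih =>
      have hs := f.D_le_exp_mul_div hM h3 h4 (f.iterate_mem hx m) (hune m)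
      rw [hu0, hu1] at hs
      rw [Finset.prod_range_succ, Finset.sum_range_succ, mul_add, Real.exp_add]
      calc _ ≤ (Real.exp (M ^ 2 * ∑ i ∈ Finset.range m, u i) * (u m / u 0)) *
            (Real.exp (M ^ 2 * u m) * (u (m + 1) / u m)) :=
            mul_le_mul ih hs (hDpos m) (mul_nonneg (Real.exp_pos _).le
              (div_nonneg (hupos m).le (hupos 0).le))
        _ = _ := by
          have := (hupos m).ne'
          field_simp
  have hphi : ∀ m : ℕ, u 0 ^ (-α) ≤ u m ^ (-α) + M * ε * m + B * ∑ i ∈ Finset.range m, u i := by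
    intro m
    induction m with
    | zero => simp
    | succ m ih =>
      have hs := f.rpow_neg_abs_step_le hM h1 h2 hα hα1 hε hη hg (f.iterate_mem hx m) (hune m)
      rw [hu0, hu1] at hs
      rw [Finset.sum_range_succ]
      push_cast
      linarith
  have hun : u n ≤ 1 := by
    have a := f.iterate_mem hx (n + 1)
    have b := f.iterate_mem hx n
    exact abs_le.2 ⟨by linarith [a.1, b.2], by linarith [a.2, b.1]⟩
  have hratio : (u n / u 0) ^ α ≤ 1 + B + Real.exp (M ^ 2) * ε * n := by
    have e : (u n / u 0) ^ α = u n ^ α * u 0 ^ (-α) := by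
      rw [Real.div_rpow (hupos n).le (hupos 0).le, Real.rpow_neg (hupos 0).le]; rfl
    have e2 : u n ^ α * u n ^ (-α) = 1 := by
      rw [← Real.rpow_add (hupos n)]; simp
    have e3 : u n ^ α ≤ 1 := Real.rpow_le_one (hupos n).le hun hα.le
    have e4 : 0 ≤ u n ^ α := Real.rpow_nonneg (hupos n).le _
    have e5 : B * ∑ i ∈ Finset.range n, u i ≤ B := mul_le_of_le_one_right hB hsum
    have e6 : M * ε * n ≤ Real.exp (M ^ 2) * ε * n := by gcongr
    have e7 : 0 ≤ Real.exp (M ^ 2) * ε * n := by positivity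
    rw [e]
    calc u n ^ α * u 0 ^ (-α) ≤ u n ^ α * (u n ^ (-α) + Real.exp (M ^ 2) * ε * n + B) := by
          gcongr
          linarith [hphi n]
      _ = 1 + u n ^ α * (B + Real.exp (M ^ 2) * ε * n) := by
          rw [add_assoc, mul_add, e2]; ring
      _ ≤ 1 + 1 * (B + Real.exp (M ^ 2) * ε * n) := by gcongr
      _ = _ := by ring
  have hfin : u n / u 0 ≤ (1 + B + Real.exp (M ^ 2) * ε * n) ^ (1 / α) := by
    have hr : 0 ≤ u n / u 0 := div_nonneg (hupos n).le (hupos 0).le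
    calc u n / u 0 = ((u n / u 0) ^ α) ^ (1 / α) := by
          rw [← Real.rpow_mul hr, mul_one_div_cancel hα.ne', Real.rpow_one]
      _ ≤ _ := by gcongr
  rw [abs_of_nonneg (Finset.prod_nonneg fun i _ => hDpos i)]
  refine (hprod n).trans (mul_le_mul (Real.exp_le_exp.2 ?_) hfin
    (div_nonneg (hupos n).le (hupos 0).le) (Real.exp_pos _).le)
  exact mul_le_of_le_one_right (by positivity) hsum

lemma gapBound_symm : ∃ M : ℝ, 1 ≤ M ∧ ∀ α ε η : ℝ, GapBound f α ε η →
    GapBound f.symm α (M * ε) η := by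
  obtain ⟨M, hM, -, -, -, -, h5⟩ := f.exists_bound
  refine ⟨M, hM, fun α ε η hg y hy hyη => ?_⟩
  change |f.invFun y - y| ≤ η at hyη
  change |D 1 f.invFun y - 1| ≤ M * ε * |f.invFun y - y| ^ α
  obtain ⟨x, hx, rfl⟩ : ∃ x ∈ Icc (0 : ℝ) 1, f.toFun x = y :=
    ⟨_, f.mapsTo_inv hy, f.rightInv hy⟩
  rw [f.leftInv hx, abs_sub_comm] at hyη
  rw [f.leftInv hx, abs_sub_comm x]
  have hD := f.D_symm_mul_D hx
  have e : D 1 f.invFun (f.toFun x) - 1 = -(D 1 f.invFun (f.toFun x) * (D 1 f.toFun x - 1)) := by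
    linear_combination hD
  rw [e, abs_neg, abs_mul, mul_assoc]
  exact mul_le_mul (h5 _ hy) (hg x hx hyη) (abs_nonneg _) (by linarith)

lemma exists_growth_le : ∃ A : ℝ, 1 ≤ A ∧ ∀ α ε η : ℝ, 0 < α → α ≤ 1 → 0 ≤ ε → 0 < η →
    GapBound f α ε η → ∃ B : ℝ, 1 ≤ B ∧
      ∀ n : ℕ, growth f n ≤ A * (B + A * ε * n) ^ (1 / α) := by
  obtain ⟨A₁, hA₁, h1⟩ := f.exists_maxAbsDeriv_le
  obtain ⟨A₂, hA₂, h2⟩ := f.symm.exists_maxAbsDeriv_le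
  obtain ⟨M, hM, hs⟩ := f.gapBound_symm
  have hA : A₁ ≤ A₁ + A₂ * M := le_add_of_nonneg_right (by positivity)
  have hA' : A₂ * M ≤ A₁ + A₂ * M := by linarith
  have hA'' : A₂ ≤ A₁ + A₂ * M := (le_mul_of_one_le_right (by linarith) hM).trans hA'
  refine ⟨A₁ + A₂ * M, hA₁.trans hA, fun α ε η hα hα1 hε hη hg => ?_⟩
  obtain ⟨B₁, hB₁, k1⟩ := h1 α ε η hα hα1 hε hη hg
  obtain ⟨B₂, hB₂, k2⟩ := h2 α (M * ε) η hα hα1 (by positivity) hη (hs α ε η hg)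
  refine ⟨max B₁ B₂, hB₁.trans (le_max_left _ _), fun n => max_le ((k1 n).trans ?_)
    ((k2 n).trans ?_)⟩
  · have := le_max_left B₁ B₂
    gcongr
  · rw [← mul_assoc A₂]
    have := le_max_right B₁ B₂
    gcongr

end IntervalDiffeo

/-! ### Gap bounds from second-order information -/

lemma D_one_eq_one {f : IntervalDiffeo} (h1 : hyperbolicSet f = ∅) {q : ℝ}
    (hq : q ∈ Icc (0 : ℝ) 1) (hfq : f.toFun q = q) : D 1 f.toFun q = 1 := by
  by_contra h
  exact (h1 ▸ (⟨⟨hq, hfq⟩, h⟩ : q ∈ hyperbolicSet f) : q ∈ (∅ : Set ℝ))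

/-- A Landau type inequality. If `d = f'(x) - 1` were large compared with the displacement, `f'`
would stay away from `1` on the segment of radius `|d| / (2 * K)` about `x`, while `f x - x` would
vanish inside that segment, contrary to the absence of hyperbolic fixed points. -/
lemma sq_D_sub_one_le {f : IntervalDiffeo} (h1 : hyperbolicSet f = ∅) {K x : ℝ} (hK : 0 < K)
    (hx : x ∈ Icc (0 : ℝ) 1)
    (hLip : ∀ y ∈ Icc (0 : ℝ) 1, |y - x| ≤ |D 1 f.toFun x - 1| / (2 * K) →
      |D 1 f.toFun y - D 1 f.toFun x| ≤ K * |y - x|) :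
    (D 1 f.toFun x - 1) ^ 2 ≤ 4 * K * |f.toFun x - x| := by
  by_contra! hlt
  set d := D 1 f.toFun x - 1 with hd
  set s := |d| / (2 * K) with hs
  have hd0 : d ≠ 0 := by
    rintro h
    rw [h] at hlt
    have : 0 ≤ 4 * K * |f.toFun x - x| := by positivity
    linarith
  have hdpos : 0 < |d| := abs_pos.2 hd0
  have hspos : 0 < s := by positivity
  have hKs : K * s = |d| / 2 := by rw [hs]; field_simp
  have hnofix : ∀ q ∈ Icc (0 : ℝ) 1, |q - x| ≤ s → f.toFun q ≠ q := by
    intro q hq hqs hfq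
    have := hLip q hq hqs
    rw [D_one_eq_one h1 hq hfq, abs_sub_comm, ← hd] at this
    nlinarith
  have hx1 : x + s < 1 := by
    by_contra! h
    exact hnofix 1 (by simp) (by rw [abs_of_nonneg (by linarith [hx.2])]; linarith) f.map_one
  have hx0 : 0 < x - s := by
    by_contra! h
    exact hnofix 0 (by simp) (by rw [abs_of_nonpos (by linarith [hx.1])]; linarith) f.map_zero
  set g := f.toFun x - x with hg
  have hgpos : 0 < |g| := abs_pos.2 (sub_ne_zero.2 (hnofix x hx (by simpa using hspos.le)))
  -- a displacement of length `s` in the direction in which `|f - id|` decreases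
  obtain ⟨t, hts, ht⟩ : ∃ t : ℝ, |t| = s ∧ t * (d * g) = -(s * (|d| * |g|)) := by
    rcases le_total 0 (d * g) with h | h
    · exact ⟨-s, by rw [abs_neg, abs_of_pos hspos], by rw [← abs_mul, abs_of_nonneg h]; ring⟩
    · exact ⟨s, abs_of_pos hspos, by rw [← abs_mul, abs_of_nonpos h]; ring⟩
  have htl := abs_le.1 hts.le
  have hyI : x + t ∈ Icc (0 : ℝ) 1 := ⟨by linarith, by linarith⟩
  have hsub : uIcc x (x + t) ⊆ Icc (0 : ℝ) 1 := ordConnected_Icc.uIcc_subset hx hyI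
  have hnear : ∀ c ∈ uIcc x (x + t), |c - x| ≤ s := fun c hc => by
    have := abs_sub_left_of_mem_uIcc hc
    rwa [add_sub_cancel_left, hts] at this
  obtain ⟨c, hc, e⟩ := exists_mem_uIcc_eq_mul (h := fun y => f.toFun y - y)
    (fun z hz => (hasDerivWithinAt_D_one f.smooth hz).sub (hasDerivWithinAt_id z _)) hx hyI
    (by
      intro h
      have : t = 0 := by linarith
      rw [this, abs_zero] at hts
      linarith)
  have hr := hLip c (hsub hc) (hnear c hc)
  set r := D 1 f.toFun c - D 1 f.toFun x with hrdef
  have hr' : |r| ≤ |d| / 2 := by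
    have := hnear c hc
    nlinarith
  have hsign : g * (f.toFun (x + t) - (x + t)) < 0 := by
    have e1 : f.toFun (x + t) - (x + t) = g + (d + r) * t := by
      have : D 1 f.toFun c - 1 = d + r := by rw [hd, hrdef]; ring
      rw [← this]
      linear_combination e
    have e2 : r * t * g ≤ |d| / 2 * s * |g| := by
      refine (le_abs_self _).trans ?_
      rw [abs_mul, abs_mul, hts]
      gcongr
    have e3 : |g| < |d| * s / 2 := by
      have : |d| * s / 2 = d ^ 2 / (4 * K) := by rw [hs, ← sq_abs]; field_simp; norm_num
      rw [this, lt_div_iff₀ (by positivity)]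
      linarith
    have e4 : g * g = |g| * |g| := (abs_mul_abs_self g).symm
    rw [e1]
    nlinarith
  have h0 : (0 : ℝ) ∈ uIcc (f.toFun x - x) (f.toFun (x + t) - (x + t)) := by
    rw [mem_uIcc, ← hg]
    rcases mul_neg_iff.1 hsign with ⟨a, b⟩ | ⟨a, b⟩
    · exact Or.inr ⟨b.le, a.le⟩
    · exact Or.inl ⟨a.le, b.le⟩
  obtain ⟨q, hq, hq0⟩ := intermediate_value_uIcc (f := fun y => f.toFun y - y)
    ((f.smooth.continuousOn.sub continuousOn_id).mono hsub) h0
  exact hnofix q (hsub hq) (hnear q hq) (sub_eq_zero.1 hq0)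

lemma abs_le_mul_rpow_half {d K u : ℝ} (hK : 0 ≤ K) (h : d ^ 2 ≤ 4 * K * u) :
    |d| ≤ Real.sqrt (4 * K) * u ^ (1 / 2 : ℝ) := by
  rw [← Real.sqrt_eq_rpow, ← Real.sqrt_mul (by positivity)]
  exact Real.abs_le_sqrt h

lemma exists_gapBound_half {f : IntervalDiffeo} (h1 : hyperbolicSet f = ∅) :
    ∃ ε, 0 ≤ ε ∧ GapBound f (1 / 2) ε 1 := by
  obtain ⟨M, hM, -, -, h3, -⟩ := f.exists_bound
  refine ⟨Real.sqrt (4 * M), Real.sqrt_nonneg _, fun x hx _ => abs_le_mul_rpow_half (by linarith)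
    (sq_D_sub_one_le h1 (by linarith) hx fun y hy _ => h3 y hy x hx)⟩

/-- By compactness a gap bound may be checked near each fixed point. The constant may be sought in
any prescribed set, since finitely many choices are combined by taking their maximum. -/
lemma exists_gapBound_of_forall_fixed {f : IntervalDiffeo} {α : ℝ} {S : Set ℝ} (hS : S.Nonempty)
    (hloc : ∀ p ∈ Icc (0 : ℝ) 1, f.toFun p = p → ∃ ε ∈ S, ∀ᶠ x in nhdsWithin p (Icc 0 1),
      |D 1 f.toFun x - 1| ≤ ε * |f.toFun x - x| ^ α) :
    ∃ ε ∈ S, ∃ η, 0 < η ∧ GapBound f α ε η := by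
  suffices h : ∃ ε ∈ S, ∃ η, 0 < η ∧ ∀ x ∈ Icc (0 : ℝ) 1, |f.toFun x - x| ≤ η →
      |D 1 f.toFun x - 1| ≤ ε * |f.toFun x - x| ^ α from h
  refine isCompact_Icc.induction_on (p := fun s => ∃ ε ∈ S, ∃ η, 0 < η ∧ ∀ x ∈ s,
    |f.toFun x - x| ≤ η → |D 1 f.toFun x - 1| ≤ ε * |f.toFun x - x| ^ α) ?_ ?_ ?_ ?_
  · obtain ⟨ε, hε⟩ := hS
    exact ⟨ε, hε, 1, one_pos, by simp⟩
  · rintro s t hst ⟨ε, hε, η, hη, h⟩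
    exact ⟨ε, hε, η, hη, fun x hx => h x (hst hx)⟩
  · rintro s t ⟨ε, hε, η, hη, h⟩ ⟨ε', hε', η', hη', h'⟩
    have hmax : max ε ε' ∈ S := by
      rcases max_choice ε ε' with e | e <;> rw [e] <;> assumption
    refine ⟨max ε ε', hmax, min η η', lt_min hη hη', ?_⟩
    rintro x (hx | hx) hu
    · refine (h x hx (hu.trans (min_le_left _ _))).trans ?_
      have := le_max_left ε ε'
      gcongr
    · refine (h' x hx (hu.trans (min_le_right _ _))).trans ?_
      have := le_max_right ε ε'
      gcongr
  · intro p hp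
    by_cases hfp : f.toFun p = p
    · obtain ⟨ε, hε, h⟩ := hloc p hp hfp
      exact ⟨_, h, ε, hε, 1, one_pos, fun x hx _ => hx⟩
    · -- near a point that is not fixed, the displacement exceeds `η`
      obtain ⟨ε, hε⟩ := hS
      have hpos : 0 < |f.toFun p - p| := abs_pos.2 (sub_ne_zero.2 hfp)
      have hcont : ContinuousWithinAt (fun x => |f.toFun x - x|) (Icc 0 1) p :=
        ((f.smooth.continuousOn.sub continuousOn_id).abs) p hp
      refine ⟨_, hcont.eventually (lt_mem_nhds (half_lt_self hpos)), ε, hε,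
        |f.toFun p - p| / 2, half_pos hpos, fun x hx hu => absurd hu (not_le.2 hx)⟩

lemma D_two (h : ℝ → ℝ) : D 2 h = D 1 (D 1 h) := by
  have : D 1 h = derivWithin h (Icc 0 1) := funext (D_one h)
  funext x
  rw [this]
  simp only [D]
  rw [iteratedDerivWithin_succ']

lemma exists_gapBound_half_of_D_two_eq_zero {f : IntervalDiffeo} (h1 : hyperbolicSet f = ∅)
    (h2 : ∀ p ∈ Icc (0 : ℝ) 1, f.toFun p = p → D 2 f.toFun p = 0) {ε : ℝ} (hε : 0 < ε) :
    ∃ η, 0 < η ∧ GapBound f (1 / 2) ε η := by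
  suffices hloc : ∀ p ∈ Icc (0 : ℝ) 1, f.toFun p = p → ∃ ε' ∈ ({ε} : Set ℝ),
      ∀ᶠ x in nhdsWithin p (Icc 0 1),
        |D 1 f.toFun x - 1| ≤ ε' * |f.toFun x - x| ^ (1 / 2 : ℝ) by
    obtain ⟨_, rfl, h⟩ := exists_gapBound_of_forall_fixed (singleton_nonempty ε) hloc
    exact h
  intro p hp hfp
  refine ⟨ε, rfl, ?_⟩
  set κ := ε ^ 2 / 4 with hκ
  have hκ0 : 0 < κ := by positivity
  have hsq : Real.sqrt (4 * κ) = ε := by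
    rw [hκ, mul_div_cancel₀ _ four_ne_zero, Real.sqrt_sq hε.le]
  have hsm := contDiffOn_D_one f.smooth
  have hcont : ContinuousWithinAt (D 1 (D 1 f.toFun)) (Icc 0 1) p :=
    (contDiffOn_D_one hsm).continuousOn p hp
  have hz : D 1 (D 1 f.toFun) p = 0 := by rw [← D_two]; exact h2 p hp hfp
  have hev : ∀ᶠ x in nhdsWithin p (Icc 0 1), |D 1 (D 1 f.toFun) x| < κ :=
    hcont.abs.eventually (gt_mem_nhds (by simpa [hz] using hκ0))
  obtain ⟨r, hr, hball⟩ := Metric.mem_nhdsWithin_iff.1 hev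
  have hLip : ∀ y ∈ Metric.ball p r ∩ Icc 0 1, ∀ x ∈ Metric.ball p r ∩ Icc 0 1,
      |D 1 f.toFun y - D 1 f.toFun x| ≤ κ * |y - x| := fun y hy x hx =>
    ((convex_ball p r).inter (convex_Icc 0 1)).norm_image_sub_le_of_norm_hasDerivWithin_le
      (fun z hz => (hasDerivWithinAt_D_one hsm hz.2).mono inter_subset_right)
      (fun z hz => (hball hz).le) hx hy
  have hp' : p ∈ Metric.ball p r ∩ Icc 0 1 := ⟨Metric.mem_ball_self hr, hp⟩
  refine Metric.mem_nhdsWithin_iff.2 ⟨r / 2, half_pos hr, fun x hx => ?_⟩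
  have hxr : |x - p| < r / 2 := by simpa [Real.dist_eq] using hx.1
  have hx' : x ∈ Metric.ball p r ∩ Icc 0 1 :=
    ⟨by rw [Metric.mem_ball, Real.dist_eq]; linarith, hx.2⟩
  have := abs_le_mul_rpow_half hκ0.le (sq_D_sub_one_le h1 hκ0 hx.2 fun y hy hyx => ?_)
  · rwa [hsq] at this
  refine hLip y ⟨?_, hy⟩ x hx'
  have k1 := hLip x hx' p hp'
  rw [D_one_eq_one h1 hp hfp] at k1
  have k2 : |y - x| ≤ r / 4 := by
    refine hyx.trans ?_
    rw [div_le_iff₀ (by positivity)]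
    nlinarith
  rw [Metric.mem_ball, Real.dist_eq]
  have := abs_sub_le y x p
  linarith

/-! ### Taylor expansion at a fixed point of finite order -/

lemma taylorWithinEval_eq_add_of_vanishing {h : ℝ → ℝ} {p : ℝ} {l n : ℕ} (hln : l < n)
    (hz : ∀ j, l < j → j < n → D j h p = 0) (x : ℝ) :
    taylorWithinEval h n (Icc 0 1) p x = taylorWithinEval h l (Icc 0 1) p x +
      D n h p / n.factorial * (x - p) ^ n := by
  induction n, hln using Nat.le_induction with
  | base =>
    rw [Nat.succ_eq_add_one, taylorWithinEval_succ, smul_eq_mul, Nat.factorial_succ]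
    simp only [D]
    push_cast
    ring
  | succ n hn ih =>
    rw [taylorWithinEval_succ, ih fun j hj hjn => hz j hj (by lia), hz n hn (by lia),
      smul_eq_mul, Nat.factorial_succ]
    simp only [D]
    push_cast
    ring

lemma eventually_abs_sub_taylor_le {h : ℝ → ℝ} (hh : ContDiffOn ℝ ∞ h (Icc 0 1)) {p : ℝ}
    (hp : p ∈ Icc (0 : ℝ) 1) {l n : ℕ} (hln : l < n)
    (hz : ∀ j, l < j → j < n → D j h p = 0) {e : ℝ} (he : 0 < e) :
    ∀ᶠ x in nhdsWithin p (Icc 0 1), |h x - taylorWithinEval h l (Icc 0 1) p x -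
      D n h p / n.factorial * (x - p) ^ n| ≤ e * |x - p| ^ n := by
  have := (taylor_isLittleO (n := n) (convex_Icc 0 1) hp
    (hh.of_le (by exact_mod_cast le_top))).def he
  filter_upwards [this] with x hx
  rw [taylorWithinEval_eq_add_of_vanishing hln hz x] at hx
  rwa [sub_sub, ← abs_pow]

lemma exists_abs_step_bounds {f : IntervalDiffeo} {k : ℕ} (hk : 2 ≤ k) {p : ℝ}
    (hp : p ∈ orderSet f k) : ∃ c C : ℝ, 0 < c ∧ 0 < C ∧ ∀ᶠ x in nhdsWithin p (Icc 0 1),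
      c * |x - p| ^ k ≤ |f.toFun x - x| ∧ |f.toFun x - x| ≤ C * |x - p| ^ k := by
  obtain ⟨⟨hpI, hfp⟩, hp1, hpj, hpk⟩ := hp
  set a := D k f.toFun p / k.factorial with ha
  have ha0 : 0 < |a| := abs_pos.2 (div_ne_zero hpk (by positivity))
  refine ⟨|a| / 2, |a| + |a| / 2, by positivity, by positivity, ?_⟩
  filter_upwards [eventually_abs_sub_taylor_le f.smooth hpI (l := 1) hk
    (fun j hj hjk => hpj j hj hjk) (half_pos ha0)] with x hx
  have e : taylorWithinEval f.toFun 1 (Icc 0 1) p x = x := by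
    rw [taylorWithinEval_succ, taylor_within_zero_eval, hfp, smul_eq_mul]
    change p + _ * D 1 f.toFun p = x
    rw [hp1]
    simp
  rw [e, ← ha] at hx
  have k1 : |a * (x - p) ^ k| = |a| * |x - p| ^ k := by rw [abs_mul, abs_pow]
  have k2 := abs_sub_abs_le_abs_sub (f.toFun x - x) (a * (x - p) ^ k)
  have k3 := abs_sub_abs_le_abs_sub (a * (x - p) ^ k) (f.toFun x - x)
  rw [abs_sub_comm (a * (x - p) ^ k)] at k3
  constructor <;> linarith

lemma exists_abs_D_sub_one_le {f : IntervalDiffeo} {k : ℕ} (hk : 2 ≤ k) {p : ℝ}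
    (hp : p ∈ orderSet f k) : ∃ C : ℝ, 0 < C ∧ ∀ᶠ x in nhdsWithin p (Icc 0 1),
      |D 1 f.toFun x - 1| ≤ C * |x - p| ^ (k - 1) := by
  obtain ⟨⟨hpI, hfp⟩, hp1, hpj, hpk⟩ := hp
  have hD : ∀ j, D j (D 1 f.toFun) p = D (j + 1) f.toFun p := fun j => by
    have : D 1 f.toFun = derivWithin f.toFun (Icc 0 1) := funext (D_one _)
    rw [this]
    simp only [D]
    rw [iteratedDerivWithin_succ']
  set a := D (k - 1) (D 1 f.toFun) p / (k - 1).factorial with ha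
  refine ⟨|a| + 1, by positivity, ?_⟩
  filter_upwards [eventually_abs_sub_taylor_le (contDiffOn_D_one f.smooth) hpI (l := 0)
    (n := k - 1) (by lia) (fun j hj hjk => by rw [hD]; exact hpj _ (by lia) (by lia))
    one_pos] with x hx
  rw [taylor_within_zero_eval, hp1, ← ha] at hx
  have k1 : |a * (x - p) ^ (k - 1)| = |a| * |x - p| ^ (k - 1) := by rw [abs_mul, abs_pow]
  have k2 := abs_sub_abs_le_abs_sub (D 1 f.toFun x - 1) (a * (x - p) ^ (k - 1))
  linarith

lemma eventually_gap_of_mem_orderSet {f : IntervalDiffeo} {k m : ℕ} (hk : 2 ≤ k) (hkm : k ≤ m)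
    {p : ℝ} (hp : p ∈ orderSet f m) : ∃ ε ∈ Ici (0 : ℝ), ∀ᶠ x in nhdsWithin p (Icc 0 1),
      |D 1 f.toFun x - 1| ≤ ε * |f.toFun x - x| ^ (((k : ℝ) - 1) / k) := by
  obtain ⟨c, _, hc, _, h⟩ := exists_abs_step_bounds (hk.trans hkm) hp
  obtain ⟨C, hC, h'⟩ := exists_abs_D_sub_one_le (hk.trans hkm) hp
  have hk0 : (0 : ℝ) < k := by positivity
  have hm0 : (0 : ℝ) < m := by
    have : 0 < m := by lia
    exact_mod_cast this
  have hk2 : (2 : ℝ) ≤ k := by exact_mod_cast hk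
  have hkm' : (k : ℝ) ≤ m := by exact_mod_cast hkm
  set β := ((m : ℝ) - 1) / m with hβ
  have hβ0 : 0 ≤ β := div_nonneg (by linarith) hm0.le
  have hle : ((k : ℝ) - 1) / k ≤ β := by
    rw [hβ, div_le_div_iff₀ hk0 hm0]
    linarith
  refine ⟨C / c ^ β, mem_Ici.2 (by positivity), ?_⟩
  filter_upwards [h, h', self_mem_nhdsWithin] with x hx hx' hxI
  have hu1 : |f.toFun x - x| ≤ 1 := by
    have a := f.mapsTo hxI
    exact abs_le.2 ⟨by linarith [a.1, hxI.2], by linarith [a.2, hxI.1]⟩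
  have hcβ := Real.rpow_pos_of_pos hc β
  have e1 : |x - p| ^ (m - 1) = (|x - p| ^ m) ^ β := by
    rw [← Real.rpow_natCast, ← Real.rpow_natCast, ← Real.rpow_mul (abs_nonneg _), hβ,
      mul_div_cancel₀ _ hm0.ne', Nat.cast_sub (by lia), Nat.cast_one]
  have e2 : c ^ β * (|x - p| ^ m) ^ β ≤ |f.toFun x - x| ^ β := by
    rw [← Real.mul_rpow hc.le (by positivity)]
    exact Real.rpow_le_rpow (by positivity) hx.1 hβ0
  have e3 : |f.toFun x - x| ^ β ≤ |f.toFun x - x| ^ (((k : ℝ) - 1) / k) := by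
    rcases (abs_nonneg (f.toFun x - x)).eq_or_lt with h0 | h0
    · have : ((k : ℝ) - 1) / k ≠ 0 := (div_pos (by linarith) hk0).ne'
      have hb : β ≠ 0 := ((div_pos (by linarith) hk0).trans_le hle).ne'
      rw [← h0, Real.zero_rpow this, Real.zero_rpow hb]
    · exact Real.rpow_le_rpow_of_exponent_ge h0 hu1 hle
  rw [e1] at hx'
  refine hx'.trans ?_
  rw [div_mul_eq_mul_div, le_div_iff₀ hcβ]
  nlinarith

lemma exists_gapBound_of_orderSet_eq_empty {f : IntervalDiffeo} (h1 : hyperbolicSet f = ∅) {k : ℕ}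
    (hk : 2 ≤ k) (hs : ∀ s : ℕ, 1 < s → s < k → orderSet f s = ∅) (hflat : flatSet f = ∅) :
    ∃ ε, 0 ≤ ε ∧ ∃ η, 0 < η ∧ GapBound f (((k : ℝ) - 1) / k) ε η := by
  refine exists_gapBound_of_forall_fixed ⟨0, self_mem_Ici⟩ fun p hp hfp => ?_
  have hd := D_one_eq_one h1 hp hfp
  have hex : ∃ j, 2 ≤ j ∧ D j f.toFun p ≠ 0 := by
    by_contra! h
    exact (hflat ▸ (⟨⟨hp, hfp⟩, hd, h⟩ : p ∈ flatSet f) : p ∈ (∅ : Set ℝ))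
  classical
  have hmem : p ∈ orderSet f (Nat.find hex) := by
    refine ⟨⟨hp, hfp⟩, hd, fun j hj hjk => ?_, (Nat.find_spec hex).2⟩
    by_contra h
    exact Nat.find_min hex hjk ⟨hj, h⟩
  refine eventually_gap_of_mem_orderSet hk ?_ hmem
  by_contra! h
  have := hs _ (Nat.find_spec hex).1 h
  rw [this] at hmem
  exact hmem

/-! ### Lower bounds for the growth -/

/-- The displacement `|f x - x|` is comparable to `|x - p| ^ k` near `p`. -/
def DisplacementOrder (f : IntervalDiffeo) (p : ℝ) (k : ℕ) : Prop :=
  ∃ c C r : ℝ, 0 < c ∧ 0 < C ∧ 0 < r ∧ ∀ x ∈ Icc (0 : ℝ) 1, |x - p| ≤ r →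
    c * |x - p| ^ k ≤ |f.toFun x - x| ∧ |f.toFun x - x| ≤ C * |x - p| ^ k

lemma displacementOrder_of_mem_orderSet {f : IntervalDiffeo} {k : ℕ} (hk : 2 ≤ k) {p : ℝ}
    (hp : p ∈ orderSet f k) : DisplacementOrder f p k := by
  obtain ⟨c, C, hc, hC, h⟩ := exists_abs_step_bounds hk hp
  obtain ⟨r, hr, hball⟩ := Metric.mem_nhdsWithin_iff.1 h
  refine ⟨c, C, r / 2, hc, hC, half_pos hr, fun x hx hxr => hball ⟨?_, hx⟩⟩
  rw [Metric.mem_ball, Real.dist_eq]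
  linarith

lemma DisplacementOrder.symm {f : IntervalDiffeo} {p : ℝ} {k : ℕ} (h : DisplacementOrder f p k)
    (hp : p ∈ Icc (0 : ℝ) 1) (hfp : f.toFun p = p) : DisplacementOrder f.symm p k := by
  obtain ⟨c, C, r, hc, hC, hr, h⟩ := h
  obtain ⟨M, hM, h1, h2, -⟩ := f.exists_bound
  have hM0 : 0 < M := by linarith
  refine ⟨c / M ^ k, C * M ^ k, r / M, by positivity, by positivity, by positivity,
    fun y hy hyr => ?_⟩
  change c / M ^ k * _ ≤ |f.invFun y - y| ∧ |f.invFun y - y| ≤ _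
  obtain ⟨x, hx, rfl⟩ : ∃ x ∈ Icc (0 : ℝ) 1, f.toFun x = y :=
    ⟨_, f.mapsTo_inv hy, f.rightInv hy⟩
  rw [f.leftInv hx, abs_sub_comm x]
  have a1 := h1 x hx p hp
  have a2 := h2 x hx p hp
  rw [hfp] at a1 a2
  have hxr : |x - p| ≤ r := a2.trans (by rwa [le_div_iff₀' hM0] at hyr)
  obtain ⟨b1, b2⟩ := h x hx hxr
  have p1 := pow_le_pow_left₀ (abs_nonneg _) a1 k
  have p2 := pow_le_pow_left₀ (abs_nonneg _) a2 k
  rw [mul_pow] at p1 p2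
  constructor
  · refine le_trans ?_ b1
    rw [div_mul_eq_mul_div, div_le_iff₀ (by positivity)]
    nlinarith
  · refine b2.trans ?_
    rw [mul_assoc]
    gcongr

/-- The discrete analogue of the decay of solutions of `t' = -c t ^ (K + 1)`. -/
lemma mul_natCast_le_inv_pow {t : ℕ → ℝ} {c : ℝ} {K : ℕ} (hK : 1 ≤ K) (hc : 0 < c)
    (ht : ∀ i, 0 < t i) (hrec : ∀ i, t (i + 1) ≤ t i - c * t i ^ (K + 1)) (n : ℕ) :
    c * n ≤ (t n ^ K)⁻¹ := by
  induction n with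
  | zero => simpa using (pow_pos (ht 0) K).le
  | succ n ih =>
    have htK := pow_pos (ht n) K
    set z := c * t n ^ K with hz
    have hz0 : 0 < z := by positivity
    have e : t (n + 1) ≤ t n * (1 - z) := by
      have := hrec n
      rw [hz]
      linear_combination this
    have hz1 : 0 < 1 - z := pos_of_mul_pos_right ((ht (n + 1)).trans_le e) (ht n).le
    have e2 : t (n + 1) ^ K ≤ t n ^ K * (1 - z) := by
      calc _ ≤ (t n * (1 - z)) ^ K := pow_le_pow_left₀ (ht _).le e K
        _ = t n ^ K * (1 - z) ^ K := mul_pow _ _ _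
        _ ≤ t n ^ K * (1 - z) := by
          gcongr
          exact pow_le_of_le_one hz1.le (by linarith) (by lia)
    have e3 : (t n ^ K)⁻¹ + c = (1 + z) / t n ^ K := by
      rw [hz]
      field_simp
    have e4 : (1 + z) / t n ^ K ≤ (t (n + 1) ^ K)⁻¹ := by
      rw [div_le_iff₀ htK, ← div_eq_inv_mul, le_div_iff₀ (pow_pos (ht _) K)]
      calc (1 + z) * t (n + 1) ^ K ≤ (1 + z) * (t n ^ K * (1 - z)) := by gcongr
        _ = t n ^ K - t n ^ K * z ^ 2 := by ring
        _ ≤ t n ^ K := by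
          have : 0 ≤ t n ^ K * z ^ 2 := by positivity
          linarith
    push_cast
    linarith

/-- `f` moves `z` towards `p`. -/
def MovesToward (f : IntervalDiffeo) (p z : ℝ) : Prop :=
  (p < z ∧ f.toFun z < z) ∨ (z < p ∧ z < f.toFun z)

lemma MovesToward.next {f : IntervalDiffeo} {p z : ℝ} (h : MovesToward f p z)
    (hp : p ∈ Icc (0 : ℝ) 1) (hfp : f.toFun p = p) (hz : z ∈ Icc (0 : ℝ) 1) :
    MovesToward f p (f.toFun z) ∧ |f.toFun z - p| = |z - p| - |f.toFun z - z| := by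
  have hfz := f.mapsTo hz
  rcases h with ⟨h, h'⟩ | ⟨h, h'⟩
  · have a := f.strictMonoOn hp hz h
    have b := f.strictMonoOn hfz hz h'
    rw [hfp] at a
    refine ⟨Or.inl ⟨a, b⟩, ?_⟩
    rw [abs_of_pos (sub_pos.2 a), abs_of_pos (sub_pos.2 h), abs_of_neg (sub_neg.2 h')]
    ring
  · have a := f.strictMonoOn hz hp h
    have b := f.strictMonoOn hz hfz h'
    rw [hfp] at a
    refine ⟨Or.inr ⟨a, b⟩, ?_⟩
    rw [abs_of_neg (sub_neg.2 a), abs_of_neg (sub_neg.2 h), abs_of_pos (sub_pos.2 h')]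
    ring

lemma growth_nonneg (f : IntervalDiffeo) (n : ℕ) : 0 ≤ growth f n :=
  ((abs_nonneg _).trans
    (f.abs_D_iterate_le_maxAbsDeriv (x := 0) (by simp) n)).trans (le_max_left _ _)

/-- If the orbit of `y` approaches `p`, then `f⁻ⁿ` expands the tiny step of the orbit at time `n`
to its first step, of fixed size. -/
lemma exists_rpow_le_growth_of_movesToward {f : IntervalDiffeo} {k : ℕ} (hk : 2 ≤ k) {p : ℝ}
    (hp : p ∈ Icc (0 : ℝ) 1) (hfp : f.toFun p = p) {c C r y : ℝ} (hc : 0 < c) (hC : 0 < C)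
    (hb : ∀ x ∈ Icc (0 : ℝ) 1, |x - p| ≤ r →
      c * |x - p| ^ k ≤ |f.toFun x - x| ∧ |f.toFun x - x| ≤ C * |x - p| ^ k)
    (hy : y ∈ Icc (0 : ℝ) 1) (hyr : |y - p| ≤ r) (hyp : MovesToward f p y) :
    ∃ a : ℝ, 0 < a ∧ ∀ n : ℕ, a * (n : ℝ) ^ ((k : ℝ) / ((k : ℝ) - 1)) ≤ growth f n := by
  obtain ⟨K, rfl⟩ : ∃ K, k = K + 1 := ⟨k - 1, by lia⟩
  have hK : 1 ≤ K := by lia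
  have hK0 : (0 : ℝ) < K := by exact_mod_cast hK
  have hmove : ∀ i, MovesToward f p (f.toFun^[i] y) ∧ |f.toFun^[i] y - p| ≤ r := by
    intro i
    induction i with
    | zero => exact ⟨hyp, hyr⟩
    | succ i ih =>
      rw [Function.iterate_succ_apply']
      obtain ⟨h1, h2⟩ := ih.1.next hp hfp (f.iterate_mem hy i)
      refine ⟨h1, ?_⟩
      rw [h2]
      linarith [ih.2, abs_nonneg (f.toFun (f.toFun^[i] y) - f.toFun^[i] y)]
  have htpos : ∀ i, 0 < |f.toFun^[i] y - p| := fun i => by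
    rcases (hmove i).1 with h | h
    · exact abs_pos.2 (sub_ne_zero.2 h.1.ne')
    · exact abs_pos.2 (sub_ne_zero.2 h.1.ne)
  have hrec : ∀ i, |f.toFun^[i + 1] y - p| ≤
      |f.toFun^[i] y - p| - c * |f.toFun^[i] y - p| ^ (K + 1) := fun i => by
    rw [Function.iterate_succ_apply', ((hmove i).1.next hp hfp (f.iterate_mem hy i)).2]
    linarith [(hb _ (f.iterate_mem hy i) (hmove i).2).1]
  have hdecay := mul_natCast_le_inv_pow hK hc htpos hrec
  set β : ℝ := ((K + 1 : ℕ) : ℝ) / (((K + 1 : ℕ) : ℝ) - 1) with hβ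
  have hβK : (K : ℝ) * β = ((K + 1 : ℕ) : ℝ) := by
    rw [hβ]
    push_cast
    rw [add_sub_cancel_right]
    field_simp
  have hβ0 : 0 ≤ β := by
    have : 0 ≤ (K : ℝ) * β := by rw [hβK]; positivity
    exact nonneg_of_mul_nonneg_right this hK0
  have hu0 : 0 < |f.toFun y - y| := by
    rcases hyp with h | h
    · exact abs_pos.2 (sub_ne_zero.2 h.2.ne)
    · exact abs_pos.2 (sub_ne_zero.2 h.2.ne')
  refine ⟨|f.toFun y - y| / C * c ^ β, by positivity, fun n => ?_⟩
  have hmvt := f.symm.abs_sub_le_growth_mul (f.iterate_mem hy n)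
    (f.iterate_mem hy (n + 1)) n
  rw [f.growth_symm] at hmvt
  change |f.invFun^[n] _ - f.invFun^[n] _| ≤ _ at hmvt
  rw [f.invFun_iterate_iterate hy, Function.iterate_succ_apply,
    f.invFun_iterate_iterate (f.mapsTo hy), ← Function.iterate_succ_apply,
    Function.iterate_succ_apply'] at hmvt
  set t := |f.toFun^[n] y - p| with ht
  have ht0 : 0 < t := htpos n
  have hpow : (c * n) ^ β * t ^ (K + 1) ≤ 1 := by
    have e : t ^ (K + 1) = (t ^ K) ^ β := by
      rw [← Real.rpow_natCast, ← Real.rpow_natCast, ← Real.rpow_mul ht0.le, hβK]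
    rw [e, ← Real.mul_rpow (by positivity) (by positivity)]
    refine Real.rpow_le_one (by positivity) ?_ hβ0
    have := hdecay n
    rwa [← one_div, le_div_iff₀ (by positivity)] at this
  have hg0 := growth_nonneg f n
  have hup := (hb _ (f.iterate_mem hy n) (hmove n).2).2
  have h1 : |f.toFun y - y| ≤ growth f n * (C * t ^ (K + 1)) :=
    hmvt.trans (mul_le_mul_of_nonneg_left hup hg0)
  have h2 : |f.toFun y - y| * (c * n) ^ β ≤ growth f n * C := by
    calc _ ≤ growth f n * (C * t ^ (K + 1)) * (c * n) ^ β := by gcongr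
      _ = growth f n * C * ((c * n) ^ β * t ^ (K + 1)) := by ring
      _ ≤ growth f n * C * 1 := by gcongr
      _ = _ := mul_one _
  rw [Real.mul_rpow hc.le (Nat.cast_nonneg n)] at h2
  rw [mul_assoc, div_mul_eq_mul_div, div_le_iff₀ hC]
  exact h2

lemma exists_rpow_le_growth {f : IntervalDiffeo} {k : ℕ} (hk : 2 ≤ k)
    (hne : (orderSet f k).Nonempty) :
    ∃ a : ℝ, 0 < a ∧ ∀ n : ℕ, a * (n : ℝ) ^ ((k : ℝ) / ((k : ℝ) - 1)) ≤ growth f n := by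
  obtain ⟨p, hpk⟩ := hne
  obtain ⟨hp, hfp⟩ := hpk.1
  have hf := displacementOrder_of_mem_orderSet hk hpk
  obtain ⟨c', C', r', hc', hC', hr', hb'⟩ := hf.symm hp hfp
  obtain ⟨c, C, r, hc, hC, hr, hb⟩ := hf
  have hfp' : f.symm.toFun p = p := by
    have := f.leftInv hp
    rwa [hfp] at this
  obtain ⟨y, hy, hyp, hyr, hyr'⟩ : ∃ y ∈ Icc (0 : ℝ) 1, y ≠ p ∧ |y - p| ≤ r ∧ |y - p| ≤ r' := by
    have hm : 0 < min (min r r') (1 / 2) := by positivity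
    have hm1 : min (min r r') (1 / 2) ≤ r := (min_le_left _ _).trans (min_le_left _ _)
    have hm2 : min (min r r') (1 / 2) ≤ r' := (min_le_left _ _).trans (min_le_right _ _)
    have hm3 : min (min r r') (1 / 2) ≤ 1 / 2 := min_le_right _ _
    set m := min (min r r') (1 / 2)
    rcases le_total p (1 / 2) with h | h
    · refine ⟨p + m, ⟨by linarith [hp.1], by linarith⟩, by linarith, ?_⟩
      rw [add_sub_cancel_left, abs_of_pos hm]
      exact ⟨hm1, hm2⟩
    · refine ⟨p - m, ⟨by linarith, by linarith [hp.2]⟩, by linarith, ?_⟩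
      rw [sub_sub_cancel_left, abs_neg, abs_of_pos hm]
      exact ⟨hm1, hm2⟩
  have hyfy : f.toFun y ≠ y := by
    have h1 : 0 < |y - p| := abs_pos.2 (sub_ne_zero.2 hyp)
    have h2 := (hb y hy hyr).1
    exact sub_ne_zero.1 (abs_pos.1 (lt_of_lt_of_le (by positivity) h2))
  -- exactly one of `f` and its inverse moves `y` towards `p`
  have hdir : MovesToward f p y ∨ MovesToward f.symm p y := by
    have hinv : f.toFun (f.invFun y) = y := f.rightInv hy
    have hlt : f.toFun y < y → y < f.invFun y := fun h => by
      rw [← f.strictMonoOn.lt_iff_lt hy (f.mapsTo_inv hy), hinv]; exact h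
    have hgt : y < f.toFun y → f.invFun y < y := fun h => by
      rw [← f.strictMonoOn.lt_iff_lt (f.mapsTo_inv hy) hy, hinv]; exact h
    rcases lt_or_gt_of_ne hyp with h | h <;> rcases lt_or_gt_of_ne hyfy with h' | h'
    · exact Or.inr (Or.inr ⟨h, hlt h'⟩)
    · exact Or.inl (Or.inr ⟨h, h'⟩)
    · exact Or.inl (Or.inl ⟨h, h'⟩)
    · exact Or.inr (Or.inl ⟨h, hgt h'⟩)
  rcases hdir with h | h
  · exact exists_rpow_le_growth_of_movesToward hk hp hfp hc hC hb hy hyr h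
  · obtain ⟨a, ha, hle⟩ := exists_rpow_le_growth_of_movesToward hk hp hfp' hc' hC' hb' hy hyr' h
    exact ⟨a, ha, fun n => (hle n).trans (f.growth_symm n).le⟩

/-! ### Asymptotics of the growth sequence -/

lemma growth_isBigO {f : IntervalDiffeo} {α ε η : ℝ} (hα : 0 < α) (hα1 : α ≤ 1) (hε : 0 ≤ ε)
    (hη : 0 < η) (hg : GapBound f α ε η) :
    (fun n : ℕ => growth f n) =O[atTop] (fun n : ℕ => (n : ℝ) ^ (1 / α)) := by
  obtain ⟨A, hA, h⟩ := f.exists_growth_le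
  obtain ⟨B, hB, h⟩ := h α ε η hα hα1 hε hη hg
  refine IsBigO.of_bound (A * (B + A * ε) ^ (1 / α)) ?_
  filter_upwards [eventually_ge_atTop 1] with n hn
  have hn' : (1 : ℝ) ≤ n := by exact_mod_cast hn
  rw [Real.norm_of_nonneg (growth_nonneg f n), Real.norm_of_nonneg (by positivity), mul_assoc,
    ← Real.mul_rpow (by positivity) (by positivity)]
  refine (h n).trans ?_
  gcongr
  nlinarith

lemma isBigO_growth {f : IntervalDiffeo} {k : ℕ} (hk : 2 ≤ k) (hne : (orderSet f k).Nonempty) :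
    (fun n : ℕ => (n : ℝ) ^ ((k : ℝ) / ((k : ℝ) - 1))) =O[atTop] (fun n : ℕ => growth f n) := by
  obtain ⟨a, ha, h⟩ := exists_rpow_le_growth hk hne
  refine IsBigO.of_bound a⁻¹ (Eventually.of_forall fun n => ?_)
  rw [Real.norm_of_nonneg (growth_nonneg f n), Real.norm_of_nonneg (by positivity),
    ← div_eq_inv_mul, le_div_iff₀ ha, mul_comm]
  exact h n

lemma growth_isLittleO_sq {f : IntervalDiffeo}
    (hg : ∀ ε : ℝ, 0 < ε → ∃ η, 0 < η ∧ GapBound f (1 / 2) ε η) :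
    (fun n : ℕ => growth f n) =o[atTop] (fun n : ℕ => (n : ℝ) ^ 2) := by
  obtain ⟨A, hA, h⟩ := f.exists_growth_le
  refine IsLittleO.of_bound fun δ hδ => ?_
  -- `ε` is chosen so that `A * (2 * A * ε * n) ^ 2 = δ * n ^ 2`
  set ε := Real.sqrt (δ / A) / (2 * A) with hεdef
  have hA0 : 0 < A := by linarith
  have hε : 0 < ε := by positivity
  obtain ⟨η, hη, hgε⟩ := hg ε hε
  obtain ⟨B, hB, hn⟩ := h _ ε η (by norm_num) (by norm_num) hε.le hη hgε
  filter_upwards [(tendsto_natCast_atTop_atTop (R := ℝ)).eventually_ge_atTop (B / (A * ε))]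
    with n hnB
  rw [div_le_iff₀ (by positivity)] at hnB
  rw [Real.norm_of_nonneg (growth_nonneg f n), Real.norm_of_nonneg (by positivity)]
  refine (hn n).trans ?_
  rw [show (1 : ℝ) / (1 / 2) = (2 : ℕ) by norm_num, Real.rpow_natCast]
  calc A * (B + A * ε * n) ^ 2 ≤ A * (2 * A * ε * n) ^ 2 := by
        gcongr
        linarith
    _ = A * (2 * A * ε) ^ 2 * n ^ 2 := by ring
    _ = δ * n ^ 2 := by
      have : 2 * A * ε = Real.sqrt (δ / A) := by rw [hεdef]; field_simp
      rw [this, Real.sq_sqrt (by positivity), mul_div_cancel₀ _ hA0.ne']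

end IntervalGrowth

theorem theorem1 (f : IntervalGrowth.IntervalDiffeo)
    (h1 : IntervalGrowth.hyperbolicSet f = ∅) :
    ((IntervalGrowth.orderSet f 2).Nonempty →
      (fun n : ℕ => IntervalGrowth.growth f n) =Θ[atTop] (fun n : ℕ => (n : ℝ) ^ 2)) ∧
    (IntervalGrowth.orderSet f 2 = ∅ → (IntervalGrowth.flatSet f).Nonempty →
      (fun n : ℕ => IntervalGrowth.growth f n) =o[atTop] (fun n : ℕ => (n : ℝ) ^ 2)) ∧
    (∀ k : ℕ, 3 ≤ k →
      (∀ s : ℕ, 1 < s → s < k → IntervalGrowth.orderSet f s = ∅) →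
      IntervalGrowth.flatSet f = ∅ →
      (IntervalGrowth.orderSet f k).Nonempty →
      (fun n : ℕ => IntervalGrowth.growth f n) =Θ[atTop]
        (fun n : ℕ => (n : ℝ) ^ ((k : ℝ) / ((k : ℝ) - 1)))) := by
  refine ⟨fun hne => ?_, fun h2 _ => ?_, fun k hk hs hflat hne => ?_⟩
  · obtain ⟨ε, hε, hg⟩ := IntervalGrowth.exists_gapBound_half h1
    have hup := IntervalGrowth.growth_isBigO (by norm_num) (by norm_num) hε one_pos hg
    have hlow := IntervalGrowth.isBigO_growth le_rfl hne
    rw [show (1 : ℝ) / (1 / 2) = (2 : ℕ) by norm_num] at hup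
    rw [show ((2 : ℕ) : ℝ) / (((2 : ℕ) : ℝ) - 1) = (2 : ℕ) by norm_num] at hlow
    simp only [Real.rpow_natCast] at hup hlow
    exact ⟨hup, hlow⟩
  · refine IntervalGrowth.growth_isLittleO_sq fun ε hε =>
      IntervalGrowth.exists_gapBound_half_of_D_two_eq_zero h1 (fun p hp hfp => ?_) hε
    by_contra h
    have : p ∈ IntervalGrowth.orderSet f 2 :=
      ⟨⟨hp, hfp⟩, IntervalGrowth.D_one_eq_one h1 hp hfp, fun j hj hj2 => by lia, h⟩
    rw [h2] at this
    exact this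
  · obtain ⟨ε, hε, η, hη, hg⟩ :=
      IntervalGrowth.exists_gapBound_of_orderSet_eq_empty h1 (by lia) hs hflat
    have hk' : (3 : ℝ) ≤ k := by exact_mod_cast hk
    have hup := IntervalGrowth.growth_isBigO (div_pos (by linarith) (by linarith))
      ((div_le_one (by linarith)).2 (by linarith)) hε hη hg
    rw [one_div_div] at hup
    exact ⟨hup, IntervalGrowth.isBigO_growth (by lia) hne⟩
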